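/- Let $\mathcal H$ be a complex Hilbert space with an orthonormal basis $\{|n\rangle\}_{n\in\mathbb N}$, $\mathbb N=\{0,1,2,\dots\}$. Let $\mathbb T=[0,2\pi)$ with addition modulo $2\pi$ be the torus, with its normalized measure $d\ell(\theta)=d\theta/2\pi$. An effect is a bounded operator $E$ on $\mathcal H$ with $0\le E\le I$; the set $\mathcal E(\mathcal H)$ of effects carries the usual operator order ($E\le F$ iff $F-E$ is positive). For $Y\subseteq\mathbb N$ let $\mathsf N(Y)=\sum_{n\in Y}|n\rangle\langle n|$ be the corresponding effect of the number observable, that is, the orthogonal projection onto the closed span of $\{|n\rangle : n\in Y\}$. For a Borel set $X\subseteq\mathbb T$ let $$\Phi(X)=\sum_{m,n=0}^\infty\int_X e^{i(m-n)\theta}\,\frac{d\theta}{2\pi}\,|m\rangle\langle n|$$ be the corresponding effect of the canonical phase observable, that is, the unique bounded operator with $\langle m|\Phi(X)|n\rangle=\int_X e^{i(m-n)\theta}\,\frac{d\theta}{2\pi}$ for all $m,n\in\mathbb N$. Theorem. Let $X\subseteq\mathbb T$ be a Borel set. Then $\Phi(X)\ne I$ if and only if $\ell(X)<1$. If $\Phi(X)\neq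 I$, then for every finite set $Y\subset\mathbb N$ the greatest lower bound of $\Phi(X)$ and $\mathsf N(Y)$ in the partially ordered set $\mathcal E(\mathcal H)$ exists and equals the null effect: $$\Phi(X)\wedge\mathsf N(Y)=0 .$$ In this sense number and canonical phase are complementary. -/

import Mathlib

open MeasureTheory AddCircle
open scoped InnerProductSpace ComplexConjugate

set_option linter.unusedSectionVars false

noncomputable section

instance fact_two_pi_pos : Fact (0 < 2 * Real.pi) := ⟨Real.two_pi_pos⟩

/-- The torus, that is, the phase interval `[0, 2π)` with addition modulo `2π`. -/
abbrev Torus : Type := AddCircle (2 * Real.pi)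

/-- The normalized measure `dℓ(θ) = dθ / 2π` on the torus. -/
abbrev ell : Measure Torus := haarAddCircle

/-- The set of effects `{E | 0 ≤ E ≤ I}` with the (Loewner) operator order. -/
abbrev Effect (H : Type*) [NormedAddCommGroup H] [InnerProductSpace ℂ H] : Type _ :=
  Set.Icc (0 : H →L[ℂ] H) 1

/-- The null effect. -/
def nullEffect (H : Type*) [NormedAddCommGroup H] [InnerProductSpace ℂ H] : Effect H :=
  ⟨0, le_rfl, (ContinuousLinearMap.nonneg_iff_isPositive _).2 ContinuousLinearMap.isPositive_one⟩

section

variable {H : Type*} [NormedAddCommGroup H] [InnerProductSpace ℂ H] [CompleteSpace H]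

/-! ### The number observable -/

/-- The closed span of the number states `|n⟩`, `n ∈ Y`. -/
def numberSubspace (b : HilbertBasis ℕ ℂ H) (Y : Set ℕ) : Submodule ℂ H :=
  (Submodule.span ℂ (b '' Y)).topologicalClosure

instance numberSubspace_hasOrthogonalProjection (b : HilbertBasis ℕ ℂ H) (Y : Set ℕ) :
    (numberSubspace b Y).HasOrthogonalProjection :=
  haveI : CompleteSpace (numberSubspace b Y) :=
    (Submodule.isClosed_topologicalClosure _).completeSpace_coe
  inferInstance

/-- The number observable, the spectral measure of the number operator `∑ n |n⟩⟨n|`: the effect of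
`Y ⊆ ℕ` is the projection `∑_{n ∈ Y} |n⟩⟨n|` onto the closed span of the `|n⟩` with `n ∈ Y`. -/
def numberObservable (b : HilbertBasis ℕ ℂ H) (Y : Set ℕ) : Effect H :=
  ⟨(numberSubspace b Y).starProjection,
    (ContinuousLinearMap.nonneg_iff_isPositive _).2
      (ContinuousLinearMap.IsPositive.of_isStarProjection isStarProjection_starProjection),
    by
      rw [← Submodule.starProjection_top', Submodule.starProjection_le_starProjection_iff]
      exact le_top⟩

open Classical in
/-- The number observable in the number basis. -/
theorem numberObservable_apply_basis (b : HilbertBasis ℕ ℂ H) (Y : Set ℕ) (n : ℕ) :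
    (numberObservable b Y : H →L[ℂ] H) (b n) = if n ∈ Y then b n else 0 := by
  have hb := b.orthonormal
  split_ifs with h
  · exact Submodule.starProjection_eq_self_iff.2
      (Submodule.le_topologicalClosure _ (Submodule.subset_span ⟨n, h, rfl⟩))
  · have hn : b n ∈ (numberSubspace b Y)ᗮ := by
      rw [numberSubspace, Submodule.orthogonal_closure, Submodule.mem_orthogonal]
      intro u hu
      induction hu using Submodule.span_induction with
      | mem x hx =>
        obtain ⟨k, hk, rfl⟩ := hx
        exact hb.2 fun hkn => h (hkn ▸ hk)
      | zero => simp
      | add x y _ _ hx hy => rw [inner_add_left, hx, hy, add_zero]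
      | smul c x _ hx => rw [inner_smul_left, hx, mul_zero]
    exact (Submodule.starProjection_apply_eq_zero_iff _).2 hn

/-! ### The canonical phase -/

/-- The number `∫_X e^{i(m-n)θ} dθ / 2π`; on the torus of length `2π`, the function `fourier k` is
`θ ↦ e^{ikθ}`. -/
def phaseMatrix (X : Set Torus) (m n : ℕ) : ℂ :=
  ∫ θ in X, fourier ((m : ℤ) - (n : ℤ)) θ ∂ell

/-- The isometry `|n⟩ ↦ e_n` of `H` into `L²` of the torus, where `e_n(θ) = e^{-inθ}`. -/
def fourierEmbedding (b : HilbertBasis ℕ ℂ H) : H →ₗᵢ[ℂ] Lp ℂ 2 ell :=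
  ((orthonormal_fourier (T := 2 * Real.pi)).comp (fun n : ℕ => -(n : ℤ))
    (fun _ _ h => by simpa using h)).orthogonalFamily.linearIsometry.comp b.repr.toLinearIsometry

theorem fourierEmbedding_basis (b : HilbertBasis ℕ ℂ H) (n : ℕ) :
    fourierEmbedding b (b n) = fourierLp 2 (-(n : ℤ)) := by
  classical
  simp [fourierEmbedding, HilbertBasis.repr_self, OrthogonalFamily.linearIsometry_apply_single]

/-- The isometry of `H` into `L²` of the torus followed by the restriction to `X`. -/
def phaseRestriction (b : HilbertBasis ℕ ℂ H) (X : Set Torus) :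
    H →L[ℂ] Lp ℂ 2 (ell.restrict X) :=
  (LpToLpRestrictCLM Torus ℂ ℂ ell 2 X).comp (fourierEmbedding b).toContinuousLinearMap

theorem inner_phaseRestriction (b : HilbertBasis ℕ ℂ H) (X : Set Torus) (m n : ℕ) :
    ⟪phaseRestriction b X (b m), phaseRestriction b X (b n)⟫_ℂ = phaseMatrix X m n := by
  rw [L2.inner_def, phaseMatrix]
  have key : ∀ k : ℕ, (phaseRestriction b X (b k) : Torus → ℂ) =ᵐ[ell.restrict X]
      fourier (-(k : ℤ)) := by
    intro k
    have h1 := LpToLpRestrictCLM_coeFn (μ := ell) (p := 2) ℂ X (fourierEmbedding b (b k))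
    have h2 : (fourierEmbedding b (b k) : Torus → ℂ) =ᵐ[ell.restrict X] fourier (-(k : ℤ)) := by
      rw [fourierEmbedding_basis]
      exact ae_restrict_of_ae (coeFn_fourierLp 2 _)
    exact h1.trans h2
  refine integral_congr_ae ?_
  filter_upwards [key m, key n] with θ hm hn
  rw [hm, hn, RCLike.inner_apply, ← fourier_neg, neg_neg, mul_comm, ← fourier_add, sub_eq_add_neg]

theorem norm_phaseRestriction_le (b : HilbertBasis ℕ ℂ H) (X : Set Torus) (x : H) :
    ‖phaseRestriction b X x‖ ≤ ‖x‖ := by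
  rw [← (fourierEmbedding b).norm_map x]
  have : ‖LpToLpRestrictCLM Torus ℂ ℂ ell 2 X‖ ≤ 1 :=
    LinearMap.mkContinuous_norm_le _ zero_le_one _
  have h := (LpToLpRestrictCLM Torus ℂ ℂ ell 2 X).le_of_opNorm_le this (fourierEmbedding b x)
  rwa [one_mul] at h

/-- A bounded operator is determined by its matrix in a Hilbert basis. -/
theorem operator_ext_basis (b : HilbertBasis ℕ ℂ H) {A B : H →L[ℂ] H}
    (h : ∀ m n, ⟪b m, A (b n)⟫_ℂ = ⟪b m, B (b n)⟫_ℂ) : A = B := by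
  refine ContinuousLinearMap.ext_on
    (Submodule.dense_iff_topologicalClosure_eq_top.2 b.dense_span) ?_
  rintro _ ⟨n, rfl⟩
  refine b.repr.injective (lp.ext (funext fun m => ?_))
  simpa [b.repr_apply_apply] using h m n

/-- There is exactly one bounded operator with the matrix `∫_X e^{i(m-n)θ} dθ / 2π` in the number
basis. -/
theorem existsUnique_phaseOperator (b : HilbertBasis ℕ ℂ H) (X : Set Torus) :
    ∃! A : H →L[ℂ] H, ∀ m n, ⟪b m, A (b n)⟫_ℂ = phaseMatrix X m n := by
  refine ⟨(phaseRestriction b X).adjoint ∘L phaseRestriction b X, fun m n => ?_, fun A hA => ?_⟩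
  · simp [ContinuousLinearMap.adjoint_inner_right, inner_phaseRestriction]
  · refine operator_ext_basis b fun m n => ?_
    simp [hA, ContinuousLinearMap.adjoint_inner_right, inner_phaseRestriction]

/-- The bounded operator `∑_{m,n} ∫_X e^{i(m-n)θ} dθ / 2π |m⟩⟨n|`, the double series being
understood, as usual, as the operator with these matrix elements. -/
def phaseOperator (b : HilbertBasis ℕ ℂ H) (X : Set Torus) : H →L[ℂ] H :=
  (existsUnique_phaseOperator b X).choose

theorem inner_phaseOperator (b : HilbertBasis ℕ ℂ H) (X : Set Torus) (m n : ℕ) :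
    ⟪b m, phaseOperator b X (b n)⟫_ℂ = phaseMatrix X m n :=
  (existsUnique_phaseOperator b X).choose_spec.1 m n

theorem phaseOperator_eq (b : HilbertBasis ℕ ℂ H) (X : Set Torus) :
    phaseOperator b X = (phaseRestriction b X).adjoint ∘L phaseRestriction b X :=
  (existsUnique_phaseOperator b X).unique (inner_phaseOperator b X) fun m n => by
    simp [ContinuousLinearMap.adjoint_inner_right, inner_phaseRestriction]

/-- The canonical phase observable `Φ`. -/
def canonicalPhase (b : HilbertBasis ℕ ℂ H) (X : Set Torus) : Effect H :=
  ⟨phaseOperator b X, by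
    rw [phaseOperator_eq, ContinuousLinearMap.nonneg_iff_isPositive]
    exact ContinuousLinearMap.isPositive_adjoint_comp_self _, by
    rw [phaseOperator_eq, ContinuousLinearMap.le_def, ContinuousLinearMap.isPositive_iff_complex]
    intro x
    have h : ⟪((1 : H →L[ℂ] H) - (phaseRestriction b X).adjoint ∘L phaseRestriction b X) x, x⟫_ℂ =
        ((‖x‖ ^ 2 - ‖phaseRestriction b X x‖ ^ 2 : ℝ) : ℂ) := by
      simp [ContinuousLinearMap.adjoint_inner_left, inner_self_eq_norm_sq_to_K]
    rw [h]
    refine ⟨rfl, ?_⟩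
    have := pow_le_pow_left₀ (norm_nonneg _) (norm_phaseRestriction_le b X x) 2
    rw [RCLike.re_to_complex, Complex.ofReal_re]
    linarith⟩

end

end

/-!
The operator `Φ(X)` is `V† V`, where `V` embeds `H` into `L²` of the torus by `|n⟩ ↦ e^{-inθ}` and
then restricts to `X`. Its diagonal matrix elements are all `ℓ(X)`, and for `ℓ(X) = 1` its matrix is
the identity by orthogonality of the characters; hence `Φ(X) = I` exactly when `ℓ(X) = 1`
(`coe_canonicalPhase_eq_one_iff`).

Let `ℓ(X) < 1`, let `E` be an effect below `Φ(X)` and `N(Y)`, and let `S` be its positive square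
root. From `E ≤ V† V` follows `|⟨u, S x⟩| ≤ ‖u‖ ‖V x‖`, so that each functional `⟨u, S ·⟩` has the
form `⟨g, V ·⟩` with `g ∈ L²(X)` (`exists_inner_eq_of_norm_le`, the step behind Douglas's
factorization lemma). From `E ≤ N(Y)` follows `S|n⟩ = 0` for `n ∉ Y`. Extended by zero, `g` thus is
a square integrable function vanishing off `X` whose Fourier coefficients vanish at all sufficiently
negative indices. Such a function is zero by the F. and M. Riesz uniqueness theorem
(`eq_zero_of_vanishing`), and therefore `S = 0` and `E = 0`.

The uniqueness theorem is obtained from a wandering vector argument of Beurling and Helson. If `f`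
vanishes on the complement of `X`, subtract from `f` its projection onto the closed span of
`e^{imθ} f`, `m ≥ 1`. The difference `h` is orthogonal to `e^{imθ} h` for `m ≥ 1`, so all Fourier
coefficients of `|h|²` but the zeroth vanish and `|h|²` is constant; but `h` vanishes on a set of
positive measure, so `h = 0` (`eq_zero_of_wandering`). Hence `f` lies in the closed span of
`e^{imθ} f`, `m ≥ 1` (`mem_shiftSpan_one`), all of whose elements have a Fourier series beginning
strictly later than that of `f`; this is impossible for a nonzero Fourier series bounded below.
-/

/-! ### Multiplication by characters and restriction on `L²` of the torus -/

/-- Multiplication by the character `e^{imθ}` as a bounded operator on `L²` of the torus. -/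
noncomputable def mulFourier (m : ℤ) : Lp ℂ 2 ell →L[ℂ] Lp ℂ 2 ell :=
  (ContinuousLinearMap.mul ℂ ℂ).holderL (ell : Measure Torus) ⊤ 2 2 (fourierLp ⊤ m)

theorem coeFn_mulFourier (m : ℤ) (f : Lp ℂ 2 (ell : Measure Torus)) :
    (mulFourier m f : Torus → ℂ) =ᵐ[ell] fun θ => fourier m θ * f θ := by
  have h := (ContinuousLinearMap.mul ℂ ℂ).coeFn_holder (r := 2) (fourierLp ⊤ m) f
  filter_upwards [h, coeFn_fourierLp (T := 2 * Real.pi) ⊤ m] with θ h1 h2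
  rw [← h2]
  exact h1

theorem mulFourier_mulFourier (m k : ℤ) (f : Lp ℂ 2 (ell : Measure Torus)) :
    mulFourier m (mulFourier k f) = mulFourier (m + k) f := by
  refine Lp.ext ?_
  filter_upwards [coeFn_mulFourier m (mulFourier k f), coeFn_mulFourier k f,
    coeFn_mulFourier (m + k) f] with θ h1 h2 h3
  rw [h1, h2, h3, fourier_add, mul_assoc]

theorem mulFourier_zero (f : Lp ℂ 2 (ell : Measure Torus)) : mulFourier 0 f = f := by
  refine Lp.ext ?_
  filter_upwards [coeFn_mulFourier 0 f] with θ h1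
  rw [h1, fourier_zero, one_mul]

theorem inner_fourierLp_mulFourier (k m : ℤ) (f : Lp ℂ 2 (ell : Measure Torus)) :
    ⟪fourierLp 2 k, mulFourier m f⟫_ℂ = ⟪fourierLp 2 (k - m), f⟫_ℂ := by
  rw [L2.inner_def, L2.inner_def]
  refine integral_congr_ae ?_
  filter_upwards [coeFn_mulFourier m f, coeFn_fourierLp (T := 2 * Real.pi) 2 k,
    coeFn_fourierLp (T := 2 * Real.pi) 2 (k - m)] with θ h1 h2 h3
  rw [h1, h2, h3, RCLike.inner_apply, RCLike.inner_apply, ← fourier_neg, ← fourier_neg,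
    show -(k - m) = m + -k by ring, fourier_add]
  ring

/-- Restriction of square integrable functions to `Z`; its kernel is the space of functions
vanishing almost everywhere on `Z`. -/
noncomputable abbrev restrictTo (Z : Set Torus) : Lp ℂ 2 ell →L[ℂ] Lp ℂ 2 (ell.restrict Z) :=
  LpToLpRestrictCLM Torus ℂ ℂ ell 2 Z

theorem restrictTo_eq_zero_iff (Z : Set Torus) (f : Lp ℂ 2 (ell : Measure Torus)) :
    restrictTo Z f = 0 ↔ (f : Torus → ℂ) =ᵐ[ell.restrict Z] 0 := by
  have h := LpToLpRestrictCLM_coeFn (μ := ell) (p := 2) ℂ Z f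
  rw [Lp.eq_zero_iff_ae_eq_zero]
  exact ⟨fun h0 => h.symm.trans h0, fun h0 => h.trans h0⟩

theorem restrictTo_mulFourier {Z : Set Torus} {f : Lp ℂ 2 (ell : Measure Torus)}
    (hf : restrictTo Z f = 0) (m : ℤ) : restrictTo Z (mulFourier m f) = 0 := by
  rw [restrictTo_eq_zero_iff] at hf ⊢
  filter_upwards [hf, ae_restrict_of_ae (coeFn_mulFourier m f)] with θ h1 h2
  rw [h2, h1]
  simp

/-! ### Fourier uniqueness and the wandering vector argument -/

/-- Finite measures on the torus with the same Fourier coefficients are equal, as the trigonometric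
polynomials form a point-separating star algebra. -/
theorem measure_ext_fourier {P Q : Measure Torus} [IsFiniteMeasure P] [IsFiniteMeasure Q]
    (h : ∀ m : ℤ, ∫ θ, fourier m θ ∂P = ∫ θ, fourier m θ ∂Q) : P = Q := by
  let A : StarSubalgebra ℂ (BoundedContinuousFunction Torus ℂ) :=
    (fourierSubalgebra (T := 2 * Real.pi)).comap
      (BoundedContinuousFunction.toContinuousMapStarₐ ℂ)
  refine ext_of_forall_mem_subalgebra_integral_eq_of_pseudoEMetric_complete_countable
    (A := A) ?_ ?_
  · intro x y hxy
    obtain ⟨_, ⟨f, hf, rfl⟩, hne⟩ := fourierSubalgebra_separatesPoints (T := 2 * Real.pi) hxy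
    refine ⟨f, ⟨f, ⟨BoundedContinuousFunction.mkOfCompact f, ?_, ?_⟩, rfl⟩, hne⟩
    · exact hf
    · rfl
  · intro g hg
    have hg' : (g : C(Torus, ℂ)) ∈ Submodule.span ℂ (Set.range (fourier (T := 2 * Real.pi))) := by
      rw [← fourierSubalgebra_coe]
      exact hg
    have key : ∀ f ∈ Submodule.span ℂ (Set.range (fourier (T := 2 * Real.pi))),
        ∫ θ, f θ ∂P = ∫ θ, f θ ∂Q := by
      have hint : ∀ (R : Measure Torus) [IsFiniteMeasure R] (f : C(Torus, ℂ)),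
          Integrable f R := fun R _ f =>
        f.continuous.integrable_of_hasCompactSupport (HasCompactSupport.of_compactSpace _)
      intro f hf
      induction hf using Submodule.span_induction with
      | mem f hf => obtain ⟨m, rfl⟩ := hf; exact h m
      | zero => simp
      | add f g _ _ hf hg =>
        simp only [ContinuousMap.add_apply]
        rw [integral_add (hint P f) (hint P g), integral_add (hint Q f) (hint Q g), hf, hg]
      | smul c f _ hf =>
        simp only [ContinuousMap.smul_apply]
        rw [integral_smul, integral_smul, hf]
    exact key g hg'

/-- The numbers `⟨h, e^{imθ} h⟩` are the Fourier coefficients of the measure `|h|² dℓ`. -/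
theorem inner_mulFourier_self (h : Lp ℂ 2 (ell : Measure Torus)) (m : ℤ) :
    ⟪h, mulFourier m h⟫_ℂ =
      ∫ θ, fourier m θ ∂(ell.withDensity fun θ => ((‖h θ‖₊ ^ 2 : NNReal) : ENNReal)) := by
  rw [integral_withDensity_eq_integral_smul
    ((Lp.stronglyMeasurable h).measurable.nnnorm.pow_const 2), L2.inner_def]
  refine integral_congr_ae ?_
  filter_upwards [coeFn_mulFourier m h] with θ h1
  rw [h1, RCLike.inner_apply, mul_assoc, RCLike.mul_conj, NNReal.smul_def, mul_comm]
  simp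

/-- If `h` is orthogonal to `e^{imθ} h` for all `m ≥ 1`, then `|h|²` is constant; so `h = 0` if `h`
vanishes on the complement of a set `X` with `ℓ(X) < 1`. -/
theorem eq_zero_of_wandering {X : Set Torus} (hX : MeasurableSet X) (hlt : ell X < 1)
    {h : Lp ℂ 2 (ell : Measure Torus)} (hh : restrictTo Xᶜ h = 0)
    (horth : ∀ m : ℤ, 1 ≤ m → ⟪h, mulFourier m h⟫_ℂ = 0) : h = 0 := by
  set P : Measure Torus := ell.withDensity fun θ => ((‖h θ‖₊ ^ 2 : NNReal) : ENNReal) with hP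
  have hL : ∫⁻ θ, ((‖h θ‖₊ ^ 2 : NNReal) : ENNReal) ∂ell < ⊤ := by
    have := (Lp.memLp h).integrable_norm_pow (by norm_num)
    have h2 := this.2
    rw [HasFiniteIntegral] at h2
    simpa [enorm_eq_nnnorm] using h2
  have : IsFiniteMeasure P := isFiniteMeasure_withDensity hL.ne
  have hPQ : P = P Set.univ • ell := by
    have : IsFiniteMeasure (P Set.univ • (ell : Measure Torus)) :=
      Measure.smul_finite _ (measure_ne_top _ _)
    refine measure_ext_fourier fun m => ?_
    rw [integral_smul_measure]
    rcases eq_or_ne m 0 with rfl | hm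
    · simp [Measure.real]
    · have hz : ∀ k : ℤ, 1 ≤ k → ∫ θ, fourier k θ ∂P = 0 := fun k hk => by
        rw [hP, ← inner_mulFourier_self, horth k hk]
      have h0 : ∫ θ, fourier m θ ∂(ell : Measure Torus) = 0 := by
        have := fourierCoeff_fourier (T := 2 * Real.pi) m
        have h1 := congrFun this 0
        simpa [fourierCoeff, hm] using h1
      rw [h0, smul_zero]
      -- The measure is real, so its coefficients at `m` and `-m` are conjugate.
      rcases lt_or_gt_of_ne hm with hm | hm
      · have := hz (-m) (by omega)
        simp only [fourier_neg] at this
        rw [integral_conj] at this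
        simpa using this
      · exact hz m (by omega)
  have hP0 : P Xᶜ = 0 := by
    rw [hP, withDensity_apply _ hX.compl]
    rw [restrictTo_eq_zero_iff] at hh
    rw [lintegral_eq_zero_iff
      ((Lp.stronglyMeasurable h).measurable.nnnorm.pow_const 2).coe_nnreal_ennreal]
    filter_upwards [hh] with θ h1
    simp [h1]
  have hXc : ell Xᶜ ≠ 0 := by
    rw [prob_compl_eq_one_sub hX]
    exact (tsub_pos_of_lt hlt).ne'
  have huniv : P Set.univ = 0 := by
    rw [hPQ, Measure.smul_apply, smul_eq_mul, mul_eq_zero] at hP0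
    exact hP0.resolve_right hXc
  rw [← inner_self_eq_zero (𝕜 := ℂ)]
  nth_rewrite 2 [← mulFourier_zero h]
  rw [inner_mulFourier_self, ← hP, Measure.measure_univ_eq_zero.1 huniv, integral_zero_measure]

/-- The closed span of the functions `e^{imθ} f` with `m ≥ k`. -/
noncomputable def shiftSpan (f : Lp ℂ 2 (ell : Measure Torus)) (k : ℤ) :
    Submodule ℂ (Lp ℂ 2 (ell : Measure Torus)) :=
  (Submodule.span ℂ ((fun m => mulFourier m f) '' Set.Ici k)).topologicalClosure

theorem mulFourier_mem_shiftSpan (f : Lp ℂ 2 (ell : Measure Torus)) {k m : ℤ} (h : k ≤ m) :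
    mulFourier m f ∈ shiftSpan f k :=
  Submodule.le_topologicalClosure _ (Submodule.subset_span ⟨m, h, rfl⟩)

theorem shiftSpan_le {f : Lp ℂ 2 (ell : Measure Torus)} {k : ℤ}
    {K : Submodule ℂ (Lp ℂ 2 (ell : Measure Torus))}
    (hK : IsClosed (K : Set (Lp ℂ 2 (ell : Measure Torus))))
    (h : ∀ m, k ≤ m → mulFourier m f ∈ K) : shiftSpan f k ≤ K := by
  refine Submodule.topologicalClosure_minimal _ (Submodule.span_le.2 ?_) hK
  rintro _ ⟨m, hm, rfl⟩
  exact h m hm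

theorem isClosed_shiftSpan (f : Lp ℂ 2 (ell : Measure Torus)) (k : ℤ) :
    IsClosed (shiftSpan f k : Set (Lp ℂ 2 (ell : Measure Torus))) :=
  Submodule.isClosed_topologicalClosure _

theorem shiftSpan_anti (f : Lp ℂ 2 (ell : Measure Torus)) {j k : ℤ} (h : j ≤ k) :
    shiftSpan f k ≤ shiftSpan f j :=
  shiftSpan_le (isClosed_shiftSpan f j) fun _ hm => mulFourier_mem_shiftSpan f (h.trans hm)

theorem self_mem_shiftSpan (f : Lp ℂ 2 (ell : Measure Torus)) : f ∈ shiftSpan f 0 := by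
  have h := mulFourier_mem_shiftSpan f (le_refl 0)
  rwa [mulFourier_zero] at h

theorem mulFourier_mem_shiftSpan_add {f g : Lp ℂ 2 (ell : Measure Torus)} {k : ℤ}
    (hg : g ∈ shiftSpan f k) (m : ℤ) : mulFourier m g ∈ shiftSpan f (m + k) := by
  have hle : shiftSpan f k ≤ (shiftSpan f (m + k)).comap (mulFourier m).toLinearMap := by
    refine shiftSpan_le ((isClosed_shiftSpan f (m + k)).preimage (mulFourier m).continuous)
      fun l hl => ?_
    rw [Submodule.mem_comap, ContinuousLinearMap.coe_coe, mulFourier_mulFourier]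
    exact mulFourier_mem_shiftSpan f (by omega)
  exact Submodule.mem_comap.1 (hle hg)

theorem restrictTo_eq_zero_of_mem_shiftSpan {Z : Set Torus}
    {f g : Lp ℂ 2 (ell : Measure Torus)} (hf : restrictTo Z f = 0) {k : ℤ}
    (hg : g ∈ shiftSpan f k) : restrictTo Z g = 0 := by
  have hle : shiftSpan f k ≤ (restrictTo Z).ker :=
    shiftSpan_le (restrictTo Z).isClosed_ker fun m _ =>
      LinearMap.mem_ker.2 (restrictTo_mulFourier hf m)
  exact LinearMap.mem_ker.1 (hle hg)

theorem exists_sub_mem_orthogonal {E : Type*} [NormedAddCommGroup E] [InnerProductSpace ℂ E]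
    [CompleteSpace E] {K : Submodule ℂ E} (hK : IsClosed (K : Set E)) (f : E) :
    ∃ p ∈ K, ∀ u ∈ K, ⟪f - p, u⟫_ℂ = 0 := by
  have : CompleteSpace K := hK.completeSpace_coe
  exact ⟨K.starProjection f, Submodule.starProjection_apply_mem _ _, fun u hu =>
    Submodule.inner_left_of_mem_orthogonal hu (Submodule.sub_starProjection_mem_orthogonal f)⟩

/-- A function vanishing on a set of positive measure lies in the closed span of its own forward
shifts: its component orthogonal to that span is a wandering vector. -/
theorem mem_shiftSpan_one {X : Set Torus} (hX : MeasurableSet X) (hlt : ell X < 1)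
    {f : Lp ℂ 2 (ell : Measure Torus)} (hf : restrictTo Xᶜ f = 0) : f ∈ shiftSpan f 1 := by
  obtain ⟨p, hp, horth⟩ := exists_sub_mem_orthogonal (isClosed_shiftSpan f 1) f
  have hmem : f - p ∈ shiftSpan f 0 :=
    sub_mem (self_mem_shiftSpan f) (shiftSpan_anti f zero_le_one hp)
  have h0 : f - p = 0 :=
    eq_zero_of_wandering hX hlt (restrictTo_eq_zero_of_mem_shiftSpan hf hmem) fun m hm =>
      horth _ (shiftSpan_anti f (by omega) (mulFourier_mem_shiftSpan_add hmem m))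
  rwa [← sub_eq_zero.1 h0] at hp

/-- The F. and M. Riesz uniqueness theorem for `L²`: a function that vanishes on a set of positive
measure and whose Fourier coefficients vanish below some index is zero. -/
theorem eq_zero_of_vanishing {X : Set Torus} (hX : MeasurableSet X) (hlt : ell X < 1)
    {f : Lp ℂ 2 (ell : Measure Torus)} (hf : restrictTo Xᶜ f = 0) {K : ℤ}
    (hK : ∀ k ≤ K, ⟪fourierLp 2 k, f⟫_ℂ = 0) : f = 0 := by
  have hmem := mem_shiftSpan_one hX hlt hf
  -- If the coefficients vanish below `k`, then the one at `k` vanishes on the whole `shiftSpan f 1`.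
  have step : ∀ n : ℕ, ∀ k ≤ K + n, ⟪fourierLp 2 k, f⟫_ℂ = 0 := by
    intro n
    induction n with
    | zero => simpa using hK
    | succ n ih =>
      intro k hk
      have : shiftSpan f 1 ≤ (innerSL ℂ (fourierLp (T := 2 * Real.pi) 2 k)).ker := by
        refine shiftSpan_le (ContinuousLinearMap.isClosed_ker _) fun m hm => ?_
        rw [LinearMap.mem_ker]
        change ⟪fourierLp 2 k, mulFourier m f⟫_ℂ = 0
        rw [inner_fourierLp_mulFourier]
        exact ih _ (by push_cast at hk; omega)
      exact this hmem
  refine (fourierBasis (T := 2 * Real.pi)).repr.injective (lp.ext (funext fun k => ?_))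
  rw [HilbertBasis.repr_apply_apply, coe_fourierBasis, map_zero]
  exact step (k - K).toNat k (by omega)

/-! ### Functionals dominated by an operator -/

/-- A functional dominated by `‖V ·‖` factors through `V`: it induces a bounded functional on the
range of `V`, which extends by Hahn–Banach and is represented by a vector. -/
theorem exists_inner_eq_of_norm_le {E F : Type*} [NormedAddCommGroup E] [InnerProductSpace ℂ E]
    [NormedAddCommGroup F] [InnerProductSpace ℂ F] [CompleteSpace F] (V : E →L[ℂ] F)
    (f : E →ₗ[ℂ] ℂ) (C : ℝ) (h : ∀ x, ‖f x‖ ≤ C * ‖V x‖) : ∃ g : F, ∀ x, f x = ⟪g, V x⟫_ℂ := by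
  have hker : f ∈ (LinearMap.ker (V : E →ₗ[ℂ] F)).dualAnnihilator := by
    rw [Submodule.mem_dualAnnihilator]
    intro x hx
    have hx' : V x = 0 := hx
    have := h x
    rw [hx', norm_zero, mul_zero] at this
    exact norm_le_zero_iff.1 this
  rw [← LinearMap.range_dualMap_eq_dualAnnihilator_ker] at hker
  obtain ⟨l, rfl⟩ := hker
  let l' : StrongDual ℂ (LinearMap.range (V : E →ₗ[ℂ] F)) :=
    (l.domRestrict (LinearMap.range (V : E →ₗ[ℂ] F))).mkContinuous C (by
      rintro ⟨_, x, rfl⟩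
      exact h x)
  obtain ⟨L, hL, -⟩ := exists_extension_norm_eq _ l'
  refine ⟨(InnerProductSpace.toDual ℂ F).symm L, fun x => ?_⟩
  rw [InnerProductSpace.toDual_symm_apply]
  exact (hL ⟨V x, x, rfl⟩).symm

/-! ### Effects below the canonical phase and the number observable -/

section

variable {H : Type*} [NormedAddCommGroup H] [InnerProductSpace ℂ H] [CompleteSpace H]

theorem coe_canonicalPhase_eq_one_iff (b : HilbertBasis ℕ ℂ H) {X : Set Torus}
    (hX : MeasurableSet X) : (canonicalPhase b X : H →L[ℂ] H) = 1 ↔ ell X = 1 := by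
  change phaseOperator b X = 1 ↔ _
  constructor
  · intro h
    have h0 := inner_phaseOperator b X 0 0
    rw [h, one_apply_eq_self, inner_self_eq_norm_sq_to_K, b.orthonormal.1] at h0
    have h1 : (ell.real X : ℂ) = 1 := by simpa [phaseMatrix] using h0.symm
    have h2 : ell.real X = 1 := by exact_mod_cast h1
    exact (ENNReal.toReal_eq_one_iff _).1 h2
  · intro h
    have hae : X =ᵐ[ell] Set.univ := by
      rw [ae_eq_univ, prob_compl_eq_zero_iff hX, h]
    refine operator_ext_basis b fun m n => ?_
    rw [inner_phaseOperator, phaseMatrix, setIntegral_congr_set hae, setIntegral_univ]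
    have h1 := congrFun (fourierCoeff_fourier (T := 2 * Real.pi) ((m : ℤ) - n)) 0
    simp only [fourierCoeff, neg_zero, fourier_zero, one_smul] at h1
    rw [h1, one_apply_eq_self, orthonormal_iff_ite.1 b.orthonormal]
    by_cases hmn : m = n
    · simp [hmn]
    · rw [if_neg hmn, Pi.single_apply, if_neg (by omega)]

/-- For `ℓ(X) < 1` and finite `Y`, the restrictions to `X` of the functions `e^{-inθ}`, `n ∉ Y`, are
still total in `L²(X)`. -/
theorem eq_zero_of_inner_phaseRestriction (b : HilbertBasis ℕ ℂ H) {X : Set Torus}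
    (hX : MeasurableSet X) (hlt : ell X < 1) {Y : Set ℕ} (hY : Y.Finite)
    {g : Lp ℂ 2 (ell.restrict X)} (hg : ∀ n ∉ Y, ⟪g, phaseRestriction b X (b n)⟫_ℂ = 0) :
    g = 0 := by
  have hmem : MemLp (X.indicator g) 2 (ell : Measure Torus) :=
    (memLp_indicator_iff_restrict hX).2 (Lp.memLp g)
  have hcoe := hmem.coeFn_toLp
  have hres : restrictTo Xᶜ (hmem.toLp _) = 0 := by
    rw [restrictTo_eq_zero_iff]
    filter_upwards [ae_restrict_of_ae hcoe, ae_restrict_mem hX.compl] with θ h1 h2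
    rw [h1, Set.indicator_of_notMem h2]
    rfl
  have hinner : ∀ n : ℕ, ⟪hmem.toLp _, fourierLp 2 (-(n : ℤ))⟫_ℂ =
      ⟪g, phaseRestriction b X (b n)⟫_ℂ := fun n => by
    rw [L2.inner_def, L2.inner_def, ← integral_indicator hX]
    have h2 := LpToLpRestrictCLM_coeFn (μ := ell) (p := 2) ℂ X (fourierEmbedding b (b n))
    rw [Filter.EventuallyEq, ae_restrict_iff' hX] at h2
    refine integral_congr_ae ?_
    filter_upwards [hcoe, h2] with θ h1 h2
    rw [h1]
    by_cases hθ : θ ∈ X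
    · rw [Set.indicator_of_mem hθ, Set.indicator_of_mem hθ, ← fourierEmbedding_basis b, ← h2 hθ]
      rfl
    · rw [Set.indicator_of_notMem hθ, Set.indicator_of_notMem hθ, inner_zero_left]
  -- Beyond the largest element of `Y`, the coefficients at `-n` vanish.
  obtain ⟨N, hN⟩ := hY.bddAbove
  have h0 : hmem.toLp _ = 0 := by
    refine eq_zero_of_vanishing hX hlt hres (K := -(N + 1 : ℤ)) fun k hk => ?_
    obtain ⟨n, rfl⟩ : ∃ n : ℕ, k = -(n : ℤ) := ⟨(-k).toNat, by omega⟩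
    rw [← inner_conj_symm, hinner, hg n fun hn => ?_, map_zero]
    have := hN hn
    omega
  rw [Lp.eq_zero_iff_ae_eq_zero] at h0 ⊢
  filter_upwards [ae_restrict_of_ae hcoe, ae_restrict_of_ae h0, ae_restrict_mem hX] with θ h1 h2 h3
  rw [← Set.indicator_of_mem h3 (g : Torus → ℂ), ← h1, h2]

theorem eq_zero_of_le_canonicalPhase_of_le_numberObservable (b : HilbertBasis ℕ ℂ H)
    {X : Set Torus} (hX : MeasurableSet X) (hlt : ell X < 1) {Y : Set ℕ} (hY : Y.Finite)
    {E : H →L[ℂ] H} (hE : 0 ≤ E) (hΦ : E ≤ canonicalPhase b X) (hN : E ≤ numberObservable b Y) :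
    E = 0 := by
  set S : H →L[ℂ] H := CFC.sqrt E with hS
  have hSS : S * S = E := CFC.sqrt_mul_sqrt_self E hE
  have hSpos : S.IsPositive :=
    (ContinuousLinearMap.nonneg_iff_isPositive _).1 (CFC.sqrt_nonneg E)
  have hnorm : ∀ x, ‖S x‖ ^ 2 = RCLike.re ⟪E x, x⟫_ℂ := fun x => by
    rw [← hSS, mul_apply_eq_comp, hSpos.inner_left_eq_inner_right,
      inner_self_eq_norm_sq]
  have hmono : ∀ {A : H →L[ℂ] H}, E ≤ A → ∀ x, ‖S x‖ ^ 2 ≤ RCLike.re ⟪A x, x⟫_ℂ := by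
    intro A hA x
    have := ((ContinuousLinearMap.le_def _ _).1 hA).re_inner_nonneg_left x
    rw [sub_apply, inner_sub_left, map_sub] at this
    rw [hnorm]
    linarith
  have hSV : ∀ x, ‖S x‖ ≤ ‖phaseRestriction b X x‖ := fun x => by
    have h := hmono hΦ x
    change _ ≤ RCLike.re ⟪phaseOperator b X x, x⟫_ℂ at h
    rw [phaseOperator_eq, ContinuousLinearMap.comp_apply, ContinuousLinearMap.adjoint_inner_left,
      inner_self_eq_norm_sq] at h
    exact le_of_sq_le_sq h (norm_nonneg _)
  have hSb : ∀ n ∉ Y, S (b n) = 0 := fun n hn => by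
    have h := hmono hN (b n)
    rw [numberObservable_apply_basis, if_neg hn, inner_zero_left, map_zero] at h
    exact norm_eq_zero.1 (pow_eq_zero_iff two_ne_zero |>.1 (le_antisymm h (sq_nonneg _)))
  have hS0 : S = 0 := by
    ext x
    refine ext_inner_left ℂ fun u => ?_
    obtain ⟨g, hg⟩ := exists_inner_eq_of_norm_le (phaseRestriction b X)
      ((innerSL ℂ u ∘L S : H →L[ℂ] ℂ) : H →ₗ[ℂ] ℂ) ‖u‖ fun x =>
        (norm_inner_le_norm u (S x)).trans (by gcongr; exact hSV x)
    have hg' : ∀ x, ⟪u, S x⟫_ℂ = ⟪g, phaseRestriction b X x⟫_ℂ := hg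
    have h0 : g = 0 := eq_zero_of_inner_phaseRestriction b hX hlt hY fun n hn => by
      rw [← hg', hSb n hn, inner_zero_right]
    rw [hg', h0]
    simp
  rw [← hSS, hS0, mul_zero]

end

theorem theorem1 {H : Type*} [NormedAddCommGroup H] [InnerProductSpace ℂ H] [CompleteSpace H]
    (b : HilbertBasis ℕ ℂ H) (X : Set Torus) (hX : MeasurableSet X) :
    ((canonicalPhase b X : H →L[ℂ] H) ≠ 1 ↔ ell X < 1) ∧
      ((canonicalPhase b X : H →L[ℂ] H) ≠ 1 → ∀ Y : Set ℕ, Y.Finite →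
        IsGLB {canonicalPhase b X, numberObservable b Y} (nullEffect H)) := by
  have hiff : (canonicalPhase b X : H →L[ℂ] H) ≠ 1 ↔ ell X < 1 := by
    rw [Ne, coe_canonicalPhase_eq_one_iff b hX, prob_le_one.lt_iff_ne]
  refine ⟨hiff, fun h Y hY => ⟨fun A _ => A.2.1, fun E hE => ?_⟩⟩
  have h0 := eq_zero_of_le_canonicalPhase_of_le_numberObservable b hX (hiff.1 h) hY E.2.1
    (hE (Set.mem_insert _ _)) (hE (Set.mem_insert_of_mem _ rfl))
  exact h0.le
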